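/- Let $A\in\mathbb R^{m\times n}$ have full row rank, let $Y^0:=\{y\in\mathbb R^m\mid \|A^\top y\|_\infty\le 1\}$, and for $\lambda\ge 0$ and $b\in\mathbb R^m$ let $T(\lambda,b)\subset\mathbb R^m$ be the set of optimal solutions of the extended dual problem $$\max_{y\in\mathbb R^m}\ \langle b,y\rangle-\frac{\lambda}{2}\|y\|^2\quad\text{subject to } y\in Y^0,$$ where $\|\cdot\|$ is the Euclidean norm. Then $(\lambda,b)\mapsto \lambda T(\lambda,b)=\{\lambda y\mid y\in T(\lambda,b)\}$ is a piecewise linear function on $[0,\infty)\times\mathbb R^m$. That is, for all $\lambda\ge 0$ and $b\in\mathbb R^m$ the set $\lambda T(\lambda,b)$ consists of exactly one point, and the graph $$\{(\lambda,b,z)\mid \lambda\ge 0,\ b\in\mathbb R^m,\ z\in\lambda T(\lambda,b)\}$$ is the union of finitely many polyhedral sets (solution sets of finite systems of non-strict linear inequalities) in $\mathbb R\times\mathbb R^m\times\mathbb R^m$. -/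

import Mathlib

namespace ExtendedL1

/-- A polyhedral set: the solution set of a finite system of linear inequalities
`α j x ≤ β j`. -/
def IsPolyhedralSet {V : Type*} [AddCommGroup V] [Module ℝ V] (C : Set V) : Prop :=
  ∃ (k : ℕ) (α : Fin k → (V →ₗ[ℝ] ℝ)) (β : Fin k → ℝ), C = {x | ∀ j, α j x ≤ β j}

/-- The graph of a multifunction. -/
def gph {V W : Type*} (G : V → Set W) : Set (V × W) := {p | p.2 ∈ G p.1}

/-- The domain of a multifunction. -/
def dom {V W : Type*} (G : V → Set W) : Set V := {x | (G x).Nonempty}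

/-- A polyhedral multifunction: its graph is the union of finitely many polyhedral sets. -/
def IsPolyhedralMultifunction {V W : Type*} [AddCommGroup V] [Module ℝ V]
    [AddCommGroup W] [Module ℝ W] (G : V → Set W) : Prop :=
  ∃ (l : ℕ) (P : Fin l → Set (V × W)), (∀ i, IsPolyhedralSet (P i)) ∧ gph G = ⋃ i, P i

/-- A multifunction is single-valued if its value at every point of its domain is a singleton. -/
def IsSingleValued {V W : Type*} (G : V → Set W) : Prop :=
  ∀ x ∈ dom G, ∃ y, G x = {y}

/-- A piecewise linear function: a single-valued polyhedral multifunction. -/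
def IsPiecewiseLinear {V W : Type*} [AddCommGroup V] [Module ℝ V]
    [AddCommGroup W] [Module ℝ W] (G : V → Set W) : Prop :=
  IsPolyhedralMultifunction G ∧ IsSingleValued G

/-- The dual feasible set `Y⁰ = {y | ‖Aᵀ y‖_∞ ≤ 1}`; the norm on `Fin n → ℝ` is the sup norm. -/
def dualFeasible {m n : ℕ} (A : Matrix (Fin m) (Fin n) ℝ) : Set (EuclideanSpace ℝ (Fin m)) :=
  {y | ‖A.transpose.mulVec y.ofLp‖ ≤ 1}

/-- The objective `⟨b, y⟩ - (λ / 2) ‖y‖²`, with the Euclidean norm. -/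
noncomputable def dualObjective {m : ℕ} (p : ℝ × EuclideanSpace ℝ (Fin m))
    (y : EuclideanSpace ℝ (Fin m)) : ℝ :=
  inner ℝ p.2 y - 1 / 2 * p.1 * ‖y‖ ^ 2

/-- The optimal solution multifunction `T : ℝ₊ × ℝᵐ ⇉ ℝᵐ` of the extended dual problem: maximize
`⟨b, y⟩ - (λ / 2) ‖y‖²` over `Y⁰`. It is empty-valued outside `ℝ₊ × ℝᵐ`. -/
def dualSolution {m n : ℕ} (A : Matrix (Fin m) (Fin n) ℝ) (p : ℝ × EuclideanSpace ℝ (Fin m)) :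
    Set (EuclideanSpace ℝ (Fin m)) :=
  {y | 0 ≤ p.1 ∧ y ∈ dualFeasible A ∧ IsMaxOn (dualObjective p) (dualFeasible A) y}

/-- The multifunction `(λ, b) ↦ λ T(λ, b) = {λ y | y ∈ T(λ, b)}`. -/
def scaledDualSolution {m n : ℕ} (A : Matrix (Fin m) (Fin n) ℝ)
    (p : ℝ × EuclideanSpace ℝ (Fin m)) : Set (EuclideanSpace ℝ (Fin m)) :=
  (fun y => p.1 • y) '' dualSolution A p

end ExtendedL1

namespace ExtendedL1

open scoped RealInnerProductSpace

/-! ### Polyhedral sets and Fourier–Motzkin elimination -/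

section Polyhedral

variable {V W : Type*} [AddCommGroup V] [Module ℝ V] [AddCommGroup W] [Module ℝ W]

/-! Completing the square shows that for `λ > 0` the set `λ T(λ, b)` is the projection of `b` onto
`λ Y⁰`, cut out by `⟪±aⱼ, w⟫ ≤ λ` with `aⱼ` the columns of `A`. At `λ = 0` full row rank collapses
this polyhedron to `{0}` and makes `Y⁰` compact, so `T` is nonempty and the description persists. By
`isProjection_iff_exists_active`, `z` is the projection iff it is feasible and `b - z` lies in the
cone generated by some set of active normals. Weyl's theorem makes this polyhedral for each of the
finitely many index sets. -/

theorem isPolyhedralSet_of_fintype {ι : Type*} [Fintype ι] (α : ι → V →ₗ[ℝ] ℝ) (β : ι → ℝ) :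
    IsPolyhedralSet {x | ∀ j, α j x ≤ β j} := by
  refine ⟨Fintype.card ι, fun k => α ((Fintype.equivFin ι).symm k),
    fun k => β ((Fintype.equivFin ι).symm k), ?_⟩
  ext x
  exact ((Fintype.equivFin ι).symm.forall_congr_right (q := fun j => α j x ≤ β j)).symm

theorem isPolyhedralSet_halfspace (α : V →ₗ[ℝ] ℝ) (β : ℝ) : IsPolyhedralSet {x | α x ≤ β} := by
  simpa using isPolyhedralSet_of_fintype (fun _ : Unit => α) (fun _ => β)

theorem IsPolyhedralSet.iInter {ι : Type*} [Fintype ι] {C : ι → Set V}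
    (hC : ∀ i, IsPolyhedralSet (C i)) : IsPolyhedralSet (⋂ i, C i) := by
  choose k α β h using hC
  convert isPolyhedralSet_of_fintype (fun j : Σ i, Fin (k i) => α j.1 j.2) (fun j => β j.1 j.2)
  ext x
  simp [h, Sigma.forall]

theorem IsPolyhedralSet.inter {C D : Set V} (hC : IsPolyhedralSet C) (hD : IsPolyhedralSet D) :
    IsPolyhedralSet (C ∩ D) := by
  rw [Set.inter_eq_iInter]
  exact IsPolyhedralSet.iInter (Bool.forall_bool.2 ⟨hD, hC⟩)

theorem IsPolyhedralSet.preimage {C : Set W} (hC : IsPolyhedralSet C) (f : V →ₗ[ℝ] W) :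
    IsPolyhedralSet (f ⁻¹' C) := by
  obtain ⟨k, α, β, rfl⟩ := hC
  exact ⟨k, fun j => α j ∘ₗ f, β, rfl⟩

/-- Fourier–Motzkin elimination of the coefficient of a single generator. -/
theorem exists_sub_smul_mem_iff (Φ : Finset (V →ₗ[ℝ] ℝ)) (v : V) :
    ∃ Ψ : Finset (V →ₗ[ℝ] ℝ), ∀ w : V,
      (∃ t : ℝ, 0 ≤ t ∧ ∀ φ ∈ Φ, φ (w - t • v) ≤ 0) ↔ ∀ ψ ∈ Ψ, ψ w ≤ 0 := by
  classical
  -- Functionals with `φ v > 0` bound `t` from below, those with `φ v < 0` from above; each paired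
  -- combination vanishes at `v`.
  refine ⟨Φ.filter (fun φ => φ v ≤ 0) ∪
    ((Φ.filter (fun φ => 0 < φ v)) ×ˢ (Φ.filter (fun φ => φ v ≤ 0))).image
      (fun q => q.1 v • q.2 - q.2 v • q.1), fun w => ⟨?_, fun h => ?_⟩⟩
  · rintro ⟨t, ht, h⟩ ψ hψ
    simp only [map_sub, map_smul, smul_eq_mul] at h
    simp only [Finset.mem_union, Finset.mem_filter, Finset.mem_image, Finset.mem_product,
      Prod.exists] at hψ
    rcases hψ with ⟨hψ, hv⟩ | ⟨φ, χ, ⟨⟨hφ, hφv⟩, hχ, hχv⟩, rfl⟩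
    · nlinarith [h ψ hψ]
    · simp only [LinearMap.sub_apply, LinearMap.smul_apply, smul_eq_mul]
      nlinarith [h φ hφ, h χ hχ]
  · have hneg : ∀ φ ∈ Φ, φ v ≤ 0 → φ w ≤ 0 := fun φ hφ hv =>
      h φ (Finset.mem_union_left _ (Finset.mem_filter.2 ⟨hφ, hv⟩))
    have hpair : ∀ φ ∈ Φ, 0 < φ v → ∀ χ ∈ Φ, χ v ≤ 0 → φ v * χ w - χ v * φ w ≤ 0 :=
      fun φ hφ hφv χ hχ hχv => h (φ v • χ - χ v • φ) (Finset.mem_union_right _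
        (Finset.mem_image.2 ⟨(φ, χ), by simp [hφ, hφv, hχ, hχv], rfl⟩))
    -- The least `t` meeting all lower bounds, including `0`.
    obtain ⟨t, ht, hmax⟩ := Finset.exists_max_image
      (insert 0 ((Φ.filter (fun φ => 0 < φ v)).image (fun φ => φ w / φ v))) id
      (Finset.insert_nonempty _ _)
    refine ⟨t, hmax 0 (Finset.mem_insert_self _ _), fun φ hφ => ?_⟩
    simp only [map_sub, map_smul, smul_eq_mul]
    rcases lt_or_ge 0 (φ v) with hv | hv
    · have : φ w / φ v ≤ t := hmax _ (Finset.mem_insert_of_mem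
        (Finset.mem_image.2 ⟨φ, Finset.mem_filter.2 ⟨hφ, hv⟩, rfl⟩))
      linarith [(div_le_iff₀ hv).1 this]
    · rcases Finset.mem_insert.1 ht with rfl | ht
      · linarith [hneg φ hφ hv]
      · obtain ⟨χ, hχ, rfl⟩ := Finset.mem_image.1 ht
        obtain ⟨hχ, hχv⟩ := Finset.mem_filter.1 hχ
        have := hpair χ hχ hχv φ hφ hv
        rw [sub_nonpos, div_mul_eq_mul_div, le_div_iff₀ hχv]
        linarith

/-- Weyl's theorem: a finitely generated cone is the solution set of finitely many homogeneous
linear inequalities. -/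
theorem exists_mem_hull_iff [FiniteDimensional ℝ V] {s : Set V} (hs : s.Finite) :
    ∃ Φ : Finset (V →ₗ[ℝ] ℝ), ∀ w : V, w ∈ PointedCone.hull ℝ s ↔ ∀ φ ∈ Φ, φ w ≤ 0 := by
  classical
  induction s, hs using Set.Finite.induction_on with
  | empty =>
    let B := Module.finBasis ℝ V
    refine ⟨Finset.univ.image B.coord ∪ Finset.univ.image (fun i => -B.coord i), fun w => ?_⟩
    have : w ∈ PointedCone.hull ℝ (∅ : Set V) ↔ w = 0 := by simp [PointedCone.hull]
    rw [this]
    refine ⟨by rintro rfl; simp, fun h => B.ext_elem fun i => ?_⟩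
    have h₁ := h (B.coord i) (by simp)
    have h₂ := h (-B.coord i) (by simp)
    simp only [LinearMap.neg_apply, Module.Basis.coord_apply] at h₁ h₂
    simp only [map_zero, Finsupp.coe_zero, Pi.zero_apply]
    linarith
  | @insert v s _ _ ih =>
    obtain ⟨Φ, hΦ⟩ := ih
    obtain ⟨Ψ, hΨ⟩ := exists_sub_smul_mem_iff Φ v
    refine ⟨Ψ, fun w => ?_⟩
    rw [← hΨ, PointedCone.hull, Submodule.mem_span_insert]
    constructor
    · rintro ⟨a, z, hz, rfl⟩
      refine ⟨a, a.2, (hΦ _).1 ?_⟩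
      have : (a : ℝ) • v = a • v := rfl
      rwa [this, add_sub_cancel_left]
    · rintro ⟨t, ht, h⟩
      exact ⟨⟨t, ht⟩, w - t • v, (hΦ _).2 h, (add_sub_cancel (t • v) w).symm⟩

end Polyhedral

/-! ### Normal cones and projections onto polyhedra -/

section NormalCone

variable {E : Type*} [NormedAddCommGroup E] [InnerProductSpace ℝ E]

theorem inner_nonpos_of_mem_hull {s : Set E} {w d : E} (hw : w ∈ PointedCone.hull ℝ s)
    (hd : ∀ v ∈ s, ⟪v, d⟫ ≤ 0) : ⟪w, d⟫ ≤ 0 := by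
  induction hw using Submodule.span_induction with
  | mem v hv => exact hd v hv
  | zero => simp
  | add x y _ _ hx hy => rw [inner_add_left]; linarith
  | smul a x _ hx =>
    have : a • x = (a : ℝ) • x := rfl
    rw [this, real_inner_smul_left]
    exact mul_nonpos_of_nonneg_of_nonpos a.2 hx

/-- The set of all `w` with `⟪w, d⟫ ≤ 0` for every `d` in the polar cone of a finite set is
polyhedral. -/
theorem isPolyhedralSet_bipolar [FiniteDimensional ℝ E] {s : Set E} (hs : s.Finite) :
    IsPolyhedralSet {w : E | ∀ d, (∀ v ∈ s, ⟪v, d⟫ ≤ 0) → ⟪w, d⟫ ≤ 0} := by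
  obtain ⟨Φ, hΦ⟩ := exists_mem_hull_iff hs
  convert isPolyhedralSet_of_fintype (fun φ : Φ => (φ : E →ₗ[ℝ] ℝ)) (fun _ => 0) using 1
  ext w
  have hR : ∀ (φ : E →ₗ[ℝ] ℝ) (x : E),
      ⟪x, (InnerProductSpace.toDual ℝ E).symm φ.toContinuousLinearMap⟫ = φ x := fun φ x => by
    rw [real_inner_comm, InnerProductSpace.toDual_symm_apply]
    rfl
  simp only [Set.mem_ofPred_eq, Subtype.forall]
  refine ⟨fun h φ hφ => ?_, fun h d hd => inner_nonpos_of_mem_hull ((hΦ w).2 h) hd⟩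
  rw [← hR]
  -- The Riesz vector of `φ` lies in the polar cone, so it can serve as `d`.
  refine h _ fun v hv => ?_
  rw [hR]
  exact (hΦ v).1 (Submodule.subset_span hv) φ hφ

/-- The variational inequality characterizing the projection `z` of `b` onto the polyhedron
`{w | ∀ j, ⟪v j, w⟫ ≤ c}`. -/
def IsProjection {ι : Type*} (v : ι → E) (c : ℝ) (b z : E) : Prop :=
  (∀ j, ⟪v j, z⟫ ≤ c) ∧ ∀ w, (∀ j, ⟪v j, w⟫ ≤ c) → ⟪b - z, w - z⟫ ≤ 0

theorem IsProjection.unique {ι : Type*} {v : ι → E} {c : ℝ} {b z z' : E}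
    (hz : IsProjection v c b z) (hz' : IsProjection v c b z') : z = z' := by
  have h₁ := hz.2 z' hz'.1
  have h₂ := hz'.2 z hz.1
  have h : ⟪z - z', z - z'⟫ = ⟪b - z, z' - z⟫ + ⟪b - z', z - z'⟫ := by
    rw [← neg_sub z z', inner_neg_right, neg_add_eq_sub, ← inner_sub_left]
    congr 1
    abel
  rw [← sub_eq_zero, ← inner_self_eq_zero (𝕜 := ℝ)]
  exact le_antisymm (h.le.trans (add_nonpos h₁ h₂)) real_inner_self_nonneg

/-- Inactive constraints survive a small step along `d`, so only active ones restrict directions.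
Allowing any set of active indices, not just the full one, avoids strict inequalities. -/
theorem isProjection_iff_exists_active {ι : Type*} [Finite ι] (v : ι → E) (c : ℝ) (b z : E) :
    IsProjection v c b z ↔ (∀ j, ⟪v j, z⟫ ≤ c) ∧ ∃ I : Set ι, (∀ j : I, c ≤ ⟪v j, z⟫) ∧
      ∀ d, (∀ u ∈ v '' I, ⟪u, d⟫ ≤ 0) → ⟪b - z, d⟫ ≤ 0 := by
  refine and_congr_right fun hz => ⟨fun h => ?_, ?_⟩
  · refine ⟨{j | c ≤ ⟪v j, z⟫}, fun j => j.2, fun d hd => ?_⟩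
    have hε : ∀ j, ∀ᶠ ε : ℝ in nhdsWithin 0 (Set.Ioi 0), ⟪v j, z + ε • d⟫ ≤ c := fun j => by
      rcases le_or_gt c ⟪v j, z⟫ with hj | hj
      · filter_upwards [self_mem_nhdsWithin] with ε hε
        rw [inner_add_right, real_inner_smul_right]
        have := mul_nonpos_of_nonneg_of_nonpos (le_of_lt hε) (hd (v j) ⟨j, hj, rfl⟩)
        linarith [hz j]
      · have hc : Continuous fun ε : ℝ => ⟪v j, z + ε • d⟫ := by fun_prop
        have := (hc.tendsto 0).eventually_lt_const (u := c) (by simpa using hj)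
        exact (this.filter_mono nhdsWithin_le_nhds).mono fun _ => le_of_lt
    obtain ⟨ε, hεc, hε0⟩ := ((Filter.eventually_all.2 hε).and self_mem_nhdsWithin).exists
    have := h _ hεc
    rw [add_sub_cancel_left, real_inner_smul_right] at this
    exact nonpos_of_mul_nonpos_right this hε0
  · rintro ⟨I, hI, hN⟩ w hw
    refine hN _ ?_
    rintro _ ⟨j, hj, rfl⟩
    rw [inner_sub_right]
    linarith [hw j, hI ⟨j, hj⟩]

/-- The projection onto `{w | ∀ j, ⟪v j, w⟫ ≤ c}`, as a multifunction of `(c, b)`, is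
polyhedral. -/
theorem isPolyhedralMultifunction_isProjection [FiniteDimensional ℝ E] {ι : Type*} [Fintype ι]
    (v : ι → E) :
    IsPolyhedralMultifunction (fun p : ℝ × E => {z | 0 ≤ p.1 ∧ IsProjection v p.1 p.2 z}) := by
  classical
  let cst : (ℝ × E) × E →ₗ[ℝ] ℝ := LinearMap.fst ℝ ℝ E ∘ₗ LinearMap.fst ℝ (ℝ × E) E
  let dif : (ℝ × E) × E →ₗ[ℝ] E :=
    LinearMap.snd ℝ ℝ E ∘ₗ LinearMap.fst ℝ (ℝ × E) E - LinearMap.snd ℝ (ℝ × E) E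
  let pair (j : ι) : (ℝ × E) × E →ₗ[ℝ] ℝ := (innerₗ E) (v j) ∘ₗ LinearMap.snd ℝ (ℝ × E) E
  let P (I : Set ι) : Set ((ℝ × E) × E) :=
    ({q | (-cst) q ≤ 0} ∩ ⋂ j, {q | (pair j - cst) q ≤ 0}) ∩
      ((⋂ j : I, {q | (cst - pair j) q ≤ 0}) ∩
        dif ⁻¹' {w : E | ∀ d, (∀ u ∈ v '' I, ⟪u, d⟫ ≤ 0) → ⟪w, d⟫ ≤ 0})
  have hP : ∀ I, IsPolyhedralSet (P I) := fun I =>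
    ((isPolyhedralSet_halfspace _ _).inter
      (IsPolyhedralSet.iInter fun _ => isPolyhedralSet_halfspace _ _)).inter
    ((IsPolyhedralSet.iInter fun _ => isPolyhedralSet_halfspace _ _).inter
      ((isPolyhedralSet_bipolar ((Set.toFinite I).image v)).preimage dif))
  refine ⟨Fintype.card (Set ι), fun i => P ((Fintype.equivFin (Set ι)).symm i), fun i => hP _, ?_⟩
  rw [(Fintype.equivFin (Set ι)).symm.surjective.iUnion_comp P]
  ext ⟨⟨c, b⟩, z⟩
  simp [gph, isProjection_iff_exists_active, P, cst, dif, pair, and_assoc]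

end NormalCone

/-! ### The dual problem as a projection -/

section Dual

variable {m n : ℕ} (A : Matrix (Fin m) (Fin n) ℝ)

/-- The columns of `A` and their negatives. -/
noncomputable def signedColumn : Fin n ⊕ Fin n → EuclideanSpace ℝ (Fin m) :=
  Sum.elim (fun j => WithLp.toLp 2 (A.transpose j)) (fun j => -WithLp.toLp 2 (A.transpose j))

theorem inner_toLp_column (j : Fin n) (y : EuclideanSpace ℝ (Fin m)) :
    ⟪WithLp.toLp 2 (A.transpose j), y⟫ = A.transpose.mulVec y.ofLp j := by
  simp [PiLp.inner_apply, Matrix.mulVec, dotProduct, mul_comm]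

theorem forall_inner_signedColumn_le_iff {c : ℝ} (hc : 0 ≤ c) (y : EuclideanSpace ℝ (Fin m)) :
    (∀ j, ⟪signedColumn A j, y⟫ ≤ c) ↔ ‖A.transpose.mulVec y.ofLp‖ ≤ c := by
  simp only [pi_norm_le_iff_of_nonneg hc, Real.norm_eq_abs, abs_le, Sum.forall, signedColumn,
    Sum.elim_inl, Sum.elim_inr, inner_neg_left, inner_toLp_column, ← forall_and]
  exact forall_congr' fun j => ⟨fun h => ⟨by linarith, h.1⟩, fun h => ⟨h.2, by linarith⟩⟩

theorem norm_mulVec_smul_le_iff {c : ℝ} (hc : 0 < c) (y : EuclideanSpace ℝ (Fin m)) :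
    ‖A.transpose.mulVec (c • y).ofLp‖ ≤ c ↔ y ∈ dualFeasible A := by
  rw [dualFeasible, Set.mem_ofPred_eq, WithLp.ofLp_smul, Matrix.mulVec_smul, norm_smul,
    Real.norm_of_nonneg hc.le]
  exact mul_le_iff_le_one_right hc

variable {A}

theorem injective_transpose_mulVec (hA : A.rank = m) :
    Function.Injective A.transpose.mulVec := by
  rw [Matrix.mulVec_injective_iff, linearIndependent_iff_card_eq_finrank_span,
    Set.finrank, ← Matrix.rank_eq_finrank_span_cols, Matrix.rank_transpose, hA, Fintype.card_fin]

/-- Full row rank makes `Aᵀ` injective, hence a closed embedding that pulls the unit ball back to a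
compact set. -/
theorem isCompact_dualFeasible (hA : A.rank = m) : IsCompact (dualFeasible A) := by
  let L : EuclideanSpace ℝ (Fin m) →ₗ[ℝ] (Fin n → ℝ) :=
    A.transpose.mulVecLin ∘ₗ (WithLp.linearEquiv 2 ℝ (Fin m → ℝ)).toLinearMap
  have hL : LinearMap.ker L = ⊥ := LinearMap.ker_eq_bot.2
    ((injective_transpose_mulVec hA).comp (WithLp.linearEquiv 2 ℝ (Fin m → ℝ)).injective)
  have hemb := LinearMap.isClosedEmbedding_of_injective hL
  have : dualFeasible A = L ⁻¹' Metric.closedBall 0 1 := by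
    ext y
    exact (mem_closedBall_zero_iff (a := L y)).symm
  rw [this]
  exact hemb.isCompact_preimage (isCompact_closedBall 0 1)

theorem dualSolution_nonempty (hA : A.rank = m) {p : ℝ × EuclideanSpace ℝ (Fin m)}
    (hp : 0 ≤ p.1) : (dualSolution A p).Nonempty := by
  have hc : Continuous (dualObjective p) := by unfold dualObjective; fun_prop
  obtain ⟨y, hy, hmax⟩ := (isCompact_dualFeasible hA).exists_isMaxOn
    ⟨0, by simp [dualFeasible]⟩ hc.continuousOn
  exact ⟨y, hp, hy, hmax⟩

/-- For `λ > 0`, maximizing the objective thus means minimizing the distance from `b` to `λ y`. -/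
theorem norm_sub_smul_sq (p : ℝ × EuclideanSpace ℝ (Fin m)) (y : EuclideanSpace ℝ (Fin m)) :
    ‖p.2 - p.1 • y‖ ^ 2 = ‖p.2‖ ^ 2 - 2 * p.1 * dualObjective p y := by
  rw [norm_sub_sq_real, real_inner_smul_right, norm_smul, mul_pow, Real.norm_eq_abs, sq_abs,
    dualObjective]
  ring

theorem isMaxOn_dualObjective_iff {p : ℝ × EuclideanSpace ℝ (Fin m)} (hp : 0 < p.1)
    {y : EuclideanSpace ℝ (Fin m)} (hy : y ∈ dualFeasible A) :
    IsMaxOn (dualObjective p) (dualFeasible A) y ↔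
      IsProjection (signedColumn A) p.1 p.2 (p.1 • y) := by
  let K : Set (EuclideanSpace ℝ (Fin m)) := {w | ∀ j, ⟪signedColumn A j, w⟫ ≤ p.1}
  have hK : ∀ w, w ∈ K ↔ ‖A.transpose.mulVec w.ofLp‖ ≤ p.1 :=
    fun w => forall_inner_signedColumn_le_iff A hp.le w
  have hconv : Convex ℝ K := by
    have : K = ⋂ j, {w | innerₗ _ (signedColumn A j) w ≤ p.1} := by ext; simp [K]
    rw [this]
    exact convex_iInter fun j => convex_halfSpace_le (LinearMap.isLinear _) _
  have hyK : p.1 • y ∈ K := (hK _).2 ((norm_mulVec_smul_le_iff A hp y).2 hy)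
  have hvar := norm_eq_iInf_iff_real_inner_le_zero hconv (u := p.2) hyK
  have hcmp : ∀ w, dualObjective p w ≤ dualObjective p y ↔ ‖p.2 - p.1 • y‖ ≤ ‖p.2 - p.1 • w‖ :=
    fun w => by
      rw [← sq_le_sq₀ (norm_nonneg _) (norm_nonneg _), norm_sub_smul_sq, norm_sub_smul_sq,
        sub_le_sub_iff_left]
      exact (mul_le_mul_iff_right₀ (by positivity)).symm
  have hbdd : BddBelow (Set.range fun w : K => ‖p.2 - w‖) :=
    ⟨0, by rintro _ ⟨w, rfl⟩; exact norm_nonneg _⟩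
  refine Iff.trans ?_ (hvar.trans (and_iff_right hyK).symm)
  constructor
  · intro hmax
    have : Nonempty K := ⟨⟨_, hyK⟩⟩
    refine le_antisymm (le_ciInf fun w => ?_) (ciInf_le hbdd ⟨_, hyK⟩)
    have hw : p.1 • p.1⁻¹ • (w : EuclideanSpace ℝ (Fin m)) = w := smul_inv_smul₀ hp.ne' _
    rw [← hw]
    refine (hcmp _).1 (hmax ?_)
    rw [← norm_mulVec_smul_le_iff A hp, hw]
    exact (hK _).1 w.2
  · intro h w hw
    refine (hcmp w).2 ?_
    rw [h]
    exact ciInf_le hbdd ⟨_, (hK _).2 ((norm_mulVec_smul_le_iff A hp w).2 hw)⟩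

/-- `λ T(λ, b)` consists of the projection of `b` onto `λ Y⁰`. -/
theorem mem_scaledDualSolution_iff (hA : A.rank = m) (p : ℝ × EuclideanSpace ℝ (Fin m))
    (z : EuclideanSpace ℝ (Fin m)) :
    z ∈ scaledDualSolution A p ↔ 0 ≤ p.1 ∧ IsProjection (signedColumn A) p.1 p.2 z := by
  rcases lt_trichotomy p.1 0 with hp | hp | hp
  · refine ⟨?_, fun h => absurd h.1 hp.not_ge⟩
    rintro ⟨y, hy, -⟩
    exact absurd hy.1 hp.not_ge
  -- At `λ = 0` the constraints say `Aᵀ w = 0`, so `w = 0`. `T(0, b)` may have many points, but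
  -- scaling by `0` merges them.
  · have hK : ∀ w : EuclideanSpace ℝ (Fin m),
        (∀ j, ⟪signedColumn A j, w⟫ ≤ p.1) ↔ w = 0 := fun w => by
      rw [forall_inner_signedColumn_le_iff A hp.ge, hp, norm_le_zero_iff,
        ← WithLp.ofLp_eq_zero 2, ← (injective_transpose_mulVec hA).eq_iff, Matrix.mulVec_zero]
    have hproj : IsProjection (signedColumn A) p.1 p.2 z ↔ z = 0 := by
      simp only [IsProjection, hK, forall_eq, and_iff_left_iff_imp]
      rintro rfl
      simp
    rw [hproj, and_iff_right hp.ge]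
    constructor
    · rintro ⟨y, -, rfl⟩
      simp [hp]
    · rintro rfl
      obtain ⟨y, hy⟩ := dualSolution_nonempty hA hp.ge
      exact ⟨y, hy, by simp [hp]⟩
  · rw [and_iff_right hp.le]
    constructor
    · rintro ⟨y, ⟨-, hy, hmax⟩, rfl⟩
      exact (isMaxOn_dualObjective_iff hp hy).1 hmax
    · intro h
      have hz : p.1 • p.1⁻¹ • z = z := smul_inv_smul₀ hp.ne' _
      have hy : p.1⁻¹ • z ∈ dualFeasible A := by
        rw [← norm_mulVec_smul_le_iff A hp, hz]
        exact (forall_inner_signedColumn_le_iff A hp.le z).1 h.1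
      exact ⟨p.1⁻¹ • z, ⟨hp.le, hy, (isMaxOn_dualObjective_iff hp hy).2 (by rwa [hz])⟩, hz⟩

end Dual

end ExtendedL1

theorem mainTheorem10 {m n : ℕ} (A : Matrix (Fin m) (Fin n) ℝ) (hA : A.rank = m) :
    ExtendedL1.dom (ExtendedL1.scaledDualSolution A) = {p | 0 ≤ p.1} ∧
      ExtendedL1.IsPiecewiseLinear (ExtendedL1.scaledDualSolution A) := by
  have hmem := ExtendedL1.mem_scaledDualSolution_iff hA
  refine ⟨?_, ?_, ?_⟩
  · ext p
    exact ⟨fun ⟨z, hz⟩ => ((hmem p z).1 hz).1,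
      fun hp => (ExtendedL1.dualSolution_nonempty hA hp).image _⟩
  · rw [show ExtendedL1.scaledDualSolution A = fun p => {z | 0 ≤ p.1 ∧
      ExtendedL1.IsProjection (ExtendedL1.signedColumn A) p.1 p.2 z} from
        funext fun p => Set.ext (hmem p)]
    exact ExtendedL1.isPolyhedralMultifunction_isProjection _
  · rintro p ⟨z, hz⟩
    exact ⟨z, Set.eq_singleton_iff_unique_mem.2 ⟨hz, fun w hw =>
      ((hmem p w).1 hw).2.unique ((hmem p z).1 hz).2⟩⟩
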